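/- Let $p\ge 3$ be an integer, $\omega_p=e^{2\pi i/p}$ and $f(z)=\sum_{k=0}^{p-1}\exp(\omega_p^k z)$ for $z\in\mathbb{C}$. For $m\in\mathbb{N}$ and $c>0$ let $T_{m,c}$ be the closed trapezium $$T_{m,c}=\{x+iy:\ (2m-1)\pi\le y\le(2m+1)\pi,\ y\le \tan(\pi/p)\,x,\ x\le c\}$$ bounded by the lines $y=\tan(\pi/p)x$, $y=(2m-1)\pi$, $y=(2m+1)\pi$ and $x=c$, and let $T_{-m,c}$ be its reflection in the real axis. Given positive integers $M$ and $K$, write $T_j=T_{M+j-1,c}$ and $T_{-j}=T_{-(M+j-1),c}$ for $1\le j\le K$, let $T^K=\bigcup_{1\le|j|\le K}T_j$ be the union of these $2K$ trapeziums, and let $$\Lambda_K=\{z\in\mathbb{C}:\ f^n(z)\in T^K \text{ for all } n\ge 0\}.$$ Let $\Sigma_K$ be the space of all one-sided sequences $s_0s_1s_2\ldots$ with $s_n\in\{\pm1,\dots,\pm K\}$, with the product of the discrete topologies, and let $\sigma(s_0s_1s_2\ldots)=s_1s_2s_3\ldots$ be the one-sided shift. Theorem. For all sufficiently large $M$ (depending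 only on $p$), every $K\ge 1$, and all sufficiently large $c$ (depending on $p$, $M$ and $K$), the set $\Lambda_K$ is homeomorphic to $\Sigma_K$, and $f|_{\Lambda_K}$ is topologically conjugate to $\sigma$: there is a homeomorphism $h:\Lambda_K\to\Sigma_K$ with $h\circ f=\sigma\circ h$ on $\Lambda_K$. -/

import Mathlib

namespace ExpSum

/-- The entire function `f(z) = ∑_{k=0}^{p-1} exp(ω_p^k z)`, where `ω_p = exp(2πi/p)`. -/
noncomputable def f (p : ℕ) (z : ℂ) : ℂ :=
  ∑ k ∈ Finset.range p, Complex.exp (Complex.exp (2 * Real.pi * Complex.I / p) ^ k * z)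

/-- The closed trapezium `T_{m,c}` bounded by the four lines
`y = tan(π/p) x`, `y = (2m-1)π`, `y = (2m+1)π` and `x = c`. -/
def trapezium (p m : ℕ) (c : ℝ) : Set ℂ :=
  {z | (2 * (m : ℝ) - 1) * Real.pi ≤ z.im ∧ z.im ≤ (2 * (m : ℝ) + 1) * Real.pi ∧
    z.im ≤ Real.tan (Real.pi / p) * z.re ∧ z.re ≤ c}

/-- The relabelled trapeziums: for `j ≥ 1`, `T_j = T_{M+j-1,c}`, and `T_{-j}` is the
reflection of `T_j` in the real axis (only indices `j ≠ 0` are ever used). -/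
noncomputable def T (p M : ℕ) (c : ℝ) (j : ℤ) : Set ℂ :=
  if 0 < j then trapezium p (M + (j.natAbs - 1)) c
  else (starRingEnd ℂ) '' trapezium p (M + (j.natAbs - 1)) c

/-- The symbols `±1, …, ±K` that label the `2K` trapeziums, with the discrete topology
(inherited from `ℤ`). -/
abbrev Symbol (K : ℕ) : Type := {j : ℤ // 1 ≤ |j| ∧ |j| ≤ (K : ℤ)}

/-- The union `T^K` of the `2K` trapeziums `T_j`, `1 ≤ |j| ≤ K`. -/
def TUnion (p M K : ℕ) (c : ℝ) : Set ℂ := ⋃ j : Symbol K, T p M c j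

/-- `Λ_K`: the points whose whole forward orbit under `f` stays in `T^K`. -/
def Lam (p M K : ℕ) (c : ℝ) : Set ℂ := {z | ∀ n : ℕ, (f p)^[n] z ∈ TUnion p M K c}

theorem mapsTo_Lam (p M K : ℕ) (c : ℝ) : Set.MapsTo (f p) (Lam p M K c) (Lam p M K c) :=
  fun _ hz n => hz (n + 1)

/-- `Σ_K`: the one-sided sequences over `±1, …, ±K`, with the product topology. -/
abbrev SeqSpace (K : ℕ) : Type := ℕ → Symbol K

/-- The one-sided shift `s₀ s₁ s₂ … ↦ s₁ s₂ s₃ …` on `Σ_K`. -/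
def shift (K : ℕ) (s : SeqSpace K) : SeqSpace K := fun n => s (n + 1)

end ExpSum

/-! In the sector `0 < arg z ≤ π/p` the terms of `f` with `k = 0` and `k = p - 1` dominate; every
other term is smaller than `exp (re z)` by a factor `exp (-gap p * ‖z‖)`. Moreover `f` commutes with
conjugation and is invariant under multiplication by `ω_p`, so it is real on the line `y = tan(π/p)
x`, the axis of the reflection `z ↦ ω_p z̄`.

Let `Ω` be the convex set `re ζ > 0`, `± im ζ > B`, `‖ζ‖ < e^c / 2`. For suitable `B`, `M`, `c` each
trapezium lies in one of the two sets `Ω`. The boundary of a trapezium is mapped off `Ω`: on the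
horizontal edges `re f ≤ 0`, on the slanted edge `f` is real, on the right edge `|f|` is about
`e^c`. Critical points do occur near the slanted edge, where the two dominant terms of `f'` can
cancel. But `|f'| < 2` forces `z` to be so close to the axis of reflection that `|im f| ≤ 4p /
sin(π/p) = B` (`exists_abs_im_f_le`), so `|f'| ≥ 2` over `Ω`.

Thus `f` is a proper local homeomorphism over the connected set `Ω`. Near the right edge `f` is
close to `exp`, which gives one value taken exactly once, so `f` is bijective over `Ω`, with an
inverse that halves distances because `Ω` is convex (`covers_and_expands`,
`trapezium_covers_and_expands`). Every trapezium therefore covers all trapeziums with expansion, and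
itineraries give the conjugacy (`exists_homeomorph_semiconj_shift`). -/

open Set Filter Topology

namespace ExpSum

/-! ### Symbolic coding, and covering over a convex region -/

/-- Symbolic coding of an expanding map: if every piece `T i` covers all pieces, the pieces are
disjoint along orbits, and the map doubles distances on them, then the invariant set is
homeomorphic to the full one-sided shift. -/
theorem exists_homeomorph_semiconj_shift {X ι : Type*} [MetricSpace X] [Finite ι]
    [TopologicalSpace ι] [DiscreteTopology ι] {g : X → X} (hg : Continuous g) {T : ι → Set X}
    (hT : ∀ i, IsCompact (T i)) (hne : ∀ i, (T i).Nonempty)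
    (hcov : ∀ i j, T j ⊆ g '' T i)
    (hdisj : ∀ i j k z, z ∈ T i → z ∈ T j → g z ∈ T k → i = j)
    (hexp : ∀ i j z z', z ∈ T i → z' ∈ T i → g z ∈ T j → g z' ∈ T j →
      2 * dist z z' ≤ dist (g z) (g z'))
    {L : Set X} (hL : L = {z | ∀ n : ℕ, g^[n] z ∈ ⋃ i, T i}) (hmaps : MapsTo g L L) :
    ∃ h : L ≃ₜ (ℕ → ι),
      Function.Semiconj h (hmaps.restrict g L L) (fun s n => s (n + 1)) := by
  have hmem : ∀ z : L, ∀ n : ℕ, ∃ i, g^[n] (z : X) ∈ T i := by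
    rintro ⟨z, hz⟩ n
    rw [hL] at hz
    exact mem_iUnion.1 (hz n)
  choose code hcode using hmem
  -- The pieces may overlap (adjacent trapeziums share an edge), so uniqueness of the symbol also
  -- uses that the next iterate lies in some piece.
  have huniq : ∀ (z : L) (n : ℕ) (i : ι), g^[n] (z : X) ∈ T i → code z n = i := by
    intro z n i hi
    refine hdisj _ _ (code z (n + 1)) _ (hcode z n) hi ?_
    rw [← Function.iterate_succ_apply' g]
    exact hcode z (n + 1)
  have hcont : Continuous code := by
    refine continuous_pi fun n => ?_
    rw [continuous_iff_isClosed]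
    intro s _
    have : (fun z => code z n) ⁻¹' s = ⋃ i ∈ s, {z : L | g^[n] (z : X) ∈ T i} := by
      ext z
      simp only [mem_preimage, mem_iUnion, mem_ofPred_eq, exists_prop]
      constructor
      · intro h
        exact ⟨_, h, hcode z n⟩
      · rintro ⟨i, his, hi⟩
        rwa [huniq z n i hi]
    rw [this]
    refine (Set.toFinite s).isClosed_biUnion fun i _ => ?_
    exact (hT i).isClosed.preimage ((hg.iterate n).comp continuous_subtype_val)
  have hinj : Function.Injective code := by
    intro z z' hzz
    by_contra hne'
    have hd : 0 < dist (z : X) z' := dist_pos.2 fun h => hne' (Subtype.ext h)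
    have hgrow : ∀ n : ℕ, 2 ^ n * dist (z : X) z' ≤ dist (g^[n] (z : X)) (g^[n] (z' : X)) := by
      intro n
      induction n with
      | zero => simp
      | succ n ih =>
        have h := hexp (code z n) (code z (n + 1)) (g^[n] (z : X)) (g^[n] (z' : X)) (hcode z n)
          (by rw [hzz]; exact hcode z' n)
          (by rw [← Function.iterate_succ_apply' g]; exact hcode z (n + 1))
          (by rw [← Function.iterate_succ_apply' g, hzz]; exact hcode z' (n + 1))
        rw [Function.iterate_succ_apply', Function.iterate_succ_apply', pow_succ]
        linarith
    have hK : IsCompact (⋃ i, T i) := isCompact_iUnion hT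
    obtain ⟨C, hC⟩ := Metric.isBounded_iff.1 hK.isBounded
    obtain ⟨n, hn⟩ := pow_unbounded_of_one_lt (C / dist (z : X) z') (one_lt_two)
    rw [div_lt_iff₀ hd] at hn
    have := hC (mem_iUnion.2 ⟨_, hcode z n⟩) (mem_iUnion.2 ⟨_, hcode z' n⟩)
    linarith [hgrow n]
  have hsurj : Function.Surjective code := by
    intro s
    -- Finite itineraries are realised backwards: a point with the shifted itinerary is pulled back
    -- into `T (s 0)`. Compactness then gives infinite ones.
    have hfin : ∀ (N : ℕ) (s : ℕ → ι), ∃ z, ∀ n ≤ N, g^[n] z ∈ T (s n) := by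
      intro N
      induction N with
      | zero =>
        intro s
        obtain ⟨z, hz⟩ := hne (s 0)
        exact ⟨z, fun n hn => by obtain rfl : n = 0 := by omega
                                 simpa using hz⟩
      | succ N ih =>
        intro s
        obtain ⟨w, hw⟩ := ih fun n => s (n + 1)
        obtain ⟨z, hz, rfl⟩ := hcov (s 0) (s 1) (by simpa using hw 0 (Nat.zero_le _))
        refine ⟨z, fun n hn => ?_⟩
        cases n with
        | zero => simpa using hz
        | succ n =>
          rw [Function.iterate_succ_apply]
          exact hw n (by omega)
    have hcl : ∀ N, IsClosed {z | ∀ n ≤ N, g^[n] z ∈ T (s n)} := by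
      intro N
      simp only [ofPred_forall]
      exact isClosed_iInter fun n => isClosed_iInter fun _ =>
        (hT _).isClosed.preimage (hg.iterate n)
    obtain ⟨z, hz⟩ := IsCompact.nonempty_iInter_of_sequence_nonempty_isCompact_isClosed
      (fun N : ℕ => {z | ∀ n ≤ N, g^[n] z ∈ T (s n)})
      (fun N z hz n hn => hz n (by omega)) (fun N => hfin N s)
      ((hT (s 0)).of_isClosed_subset (hcl 0) fun z hz => by simpa using hz 0 le_rfl) hcl
    rw [mem_iInter] at hz
    have hz' : ∀ n, g^[n] z ∈ T (s n) := fun n => hz n n le_rfl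
    refine ⟨⟨z, ?_⟩, ?_⟩
    · rw [hL]
      exact fun n => mem_iUnion.2 ⟨_, hz' n⟩
    · funext n
      exact huniq _ _ _ (hz' n)
  have hLc : IsCompact L := by
    refine (isCompact_iUnion hT).of_isClosed_subset ?_ fun z hz => ?_
    · rw [hL]
      simp only [ofPred_forall]
      exact isClosed_iInter fun n =>
        (isCompact_iUnion hT).isClosed.preimage (hg.iterate n)
    · rw [hL] at hz
      exact hz 0
  have : CompactSpace L := isCompact_iff_compactSpace.1 hLc
  refine ⟨Continuous.homeoOfEquivCompactToT2 (f := Equiv.ofBijective code ⟨hinj, hsurj⟩) hcont, ?_⟩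
  intro z
  funext n
  change code (hmaps.restrict g L L z) n = code z (n + 1)
  refine huniq _ _ _ ?_
  have := hcode z (n + 1)
  rwa [Function.iterate_succ_apply] at this

/-- A differentiable map of a compact set whose boundary avoids a convex open region `Ω`, expanding
over `Ω` and with a value of multiplicity one there, covers `Ω` and doubles distances over it. -/
theorem covers_and_expands {g : ℂ → ℂ} (hg : Differentiable ℂ g) {A U Ω : Set ℂ}
    (hA : IsCompact A) (hU : IsOpen U) (hUA : U ⊆ A) (hΩ : IsOpen Ω) (hconv : Convex ℝ Ω)
    (hb : ∀ z ∈ A, g z ∈ Ω → z ∈ U) (hd : ∀ z ∈ A, g z ∈ Ω → 2 ≤ ‖deriv g z‖)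
    {z₀ : ℂ} (hz₀ : z₀ ∈ A) (hgz₀ : g z₀ ∈ Ω) (huniq : ∀ z ∈ A, g z = g z₀ → z = z₀) :
    Ω ⊆ g '' A ∧ ∀ z ∈ A, ∀ z' ∈ A, g z ∈ Ω → g z' ∈ Ω → 2 * ‖z - z'‖ ≤ ‖g z - g z'‖ := by
  have hstrict : ∀ z, HasStrictDerivAt g (deriv g z) z := fun z =>
    (hg.contDiff (n := 1)).contDiffAt.hasStrictDerivAt one_ne_zero
  have hne : ∀ z ∈ A, g z ∈ Ω → deriv g z ≠ 0 := fun z hz hgz h0 => by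
    have := hd z hz hgz
    rw [h0, norm_zero] at this
    linarith
  have hopen : ∀ z ∈ A, g z ∈ Ω → ∀ V ∈ 𝓝 z, g '' V ∈ 𝓝 (g z) := fun z hz hgz V hV => by
    rw [← (hstrict z).map_nhds_eq (hne z hz hgz)]
    exact image_mem_map hV
  have hAnhds : ∀ z ∈ A, g z ∈ Ω → A ∈ 𝓝 z := fun z hz hgz =>
    mem_of_superset (hU.mem_nhds (hb z hz hgz)) hUA
  -- The part of the image in `Ω` is open since `g` is a local homeomorphism there, relatively
  -- closed since `A` is compact, and `Ω` is connected.
  have hcov : Ω ⊆ g '' A := by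
    have hsub : Ω ⊆ g '' A ∩ Ω := by
      refine hconv.isPreconnected.subset_of_closure_inter_subset ?_
        ⟨g z₀, hgz₀, mem_image_of_mem g hz₀, hgz₀⟩ ?_
      · rw [isOpen_iff_mem_nhds]
        rintro _ ⟨⟨z, hz, rfl⟩, hgz⟩
        exact inter_mem (hopen z hz hgz A (hAnhds z hz hgz)) (hΩ.mem_nhds hgz)
      · rintro ζ ⟨hζ, hζΩ⟩
        refine ⟨?_, hζΩ⟩
        have hcl : IsClosed (g '' A) := (hA.image hg.continuous).isClosed
        exact hcl.closure_subset (closure_mono inter_subset_left hζ)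
    exact fun ζ hζ => (hsub hζ).1
  have hinj : ∀ z ∈ A, ∀ z' ∈ A, g z ∈ Ω → g z = g z' → z = z' := by
    intro a ha a' ha' hga haa
    by_contra hneq
    -- The values with two distinct preimages also form a relatively clopen subset of `Ω`; it misses
    -- `g z₀`, so it is empty.
    let S : Set ℂ := {ζ | ζ ∈ Ω ∧ ∃ z ∈ A, ∃ z' ∈ A, z ≠ z' ∧ g z = ζ ∧ g z' = ζ}
    have hsub : Ω ⊆ S := by
      refine hconv.isPreconnected.subset_of_closure_inter_subset ?_
        ⟨g a, hga, hga, a, ha, a', ha', hneq, rfl, haa.symm⟩ ?_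
      · rw [isOpen_iff_mem_nhds]
        rintro ζ ⟨hζ, z, hz, z', hz', hzz, rfl, hz'e⟩
        obtain ⟨V, V', hV, hV', hVV⟩ := t2_separation_nhds hzz
        have h1 := hopen z hz hζ _ (inter_mem hV (hAnhds z hz hζ))
        have h2 := hopen z' hz' (hz'e ▸ hζ) _ (inter_mem hV' (hAnhds z' hz' (hz'e ▸ hζ)))
        rw [hz'e] at h2
        filter_upwards [h1, h2, hΩ.mem_nhds hζ]
        rintro ξ ⟨w, ⟨hwV, hwA⟩, hw⟩ ⟨w', ⟨hwV', hwA'⟩, hw'⟩ hξ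
        exact ⟨hξ, w, hwA, w', hwA', fun h => hVV.le_bot ⟨hwV, h ▸ hwV'⟩, hw, hw'⟩
      · rintro ζ ⟨hζ, hζΩ⟩
        obtain ⟨u, hu, hulim⟩ := mem_closure_iff_seq_limit.1 hζ
        have hu' : ∀ n, ∃ q ∈ A ×ˢ A, q.1 ≠ q.2 ∧ g q.1 = u n ∧ g q.2 = u n := by
          intro n
          obtain ⟨-, z, hz, z', hz', h1, h2, h3⟩ := hu n
          exact ⟨(z, z'), ⟨hz, hz'⟩, h1, h2, h3⟩
        choose q hqA hqne hq1 hq2 using hu'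
        obtain ⟨⟨z, z'⟩, hzA, φ, hφ, hlim⟩ := (hA.prod hA).tendsto_subseq hqA
        have hl := hulim.comp hφ.tendsto_atTop
        have hl1 : Tendsto (fun n => (q (φ n)).1) atTop (𝓝 z) :=
          (continuous_fst.tendsto _).comp hlim
        have hl2 : Tendsto (fun n => (q (φ n)).2) atTop (𝓝 z') :=
          (continuous_snd.tendsto _).comp hlim
        have hgz : g z = ζ := tendsto_nhds_unique ((hg.continuous.tendsto z).comp hl1)
          (hl.congr fun n => (hq1 _).symm)
        have hgz' : g z' = ζ := tendsto_nhds_unique ((hg.continuous.tendsto z').comp hl2)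
          (hl.congr fun n => (hq2 _).symm)
        refine ⟨hζΩ, z, hzA.1, z', hzA.2, ?_, hgz, hgz'⟩
        -- If the two preimages merged in the limit, `g` would fail to be injective near `z`, where
        -- its derivative is nonzero.
        rintro rfl
        have hloc := (hstrict z).eventually_left_inverse (hne z hzA.1 (hgz ▸ hζΩ))
        obtain ⟨n, hn1, hn2⟩ := ((hl1.eventually hloc).and (hl2.eventually hloc)).exists
        refine hqne (φ n) ?_
        rw [← hn1, ← hn2, hq1, hq2]
    obtain ⟨-, z, hz, z', hz', h1, h2, h3⟩ := hsub hgz₀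
    exact h1 ((huniq z hz h2).trans (huniq z' hz' h3).symm)
  refine ⟨hcov, fun z hz z' hz' hgz hgz' => ?_⟩
  have hpre : ∀ ζ ∈ Ω, ∃ z, z ∈ A ∧ g z = ζ := fun ζ hζ => hcov hζ
  choose! G hGA hG using hpre
  have hGl : ∀ z ∈ A, g z ∈ Ω → G (g z) = z := fun z hz hgz =>
    hinj _ (hGA _ hgz) _ hz (by rwa [hG _ hgz]) (hG _ hgz)
  have hderiv : ∀ ζ ∈ Ω, HasDerivWithinAt G (deriv g (G ζ))⁻¹ Ω ζ := by
    intro ζ hζ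
    have hGζ : g (G ζ) ∈ Ω := by rwa [hG _ hζ]
    have hn0 := hne _ (hGA _ hζ) hGζ
    have hinv := (hstrict (G ζ)).to_localInverse hn0
    have hri := (hstrict (G ζ)).eventually_right_inverse hn0
    have hct := hinv.hasDerivAt.continuousAt
    have hval := (hstrict (G ζ)).eventually_left_inverse hn0 |>.self_of_nhds
    rw [hG _ hζ] at hinv hri hct hval
    -- The local inverse takes values in `A` near `ζ`, so by injectivity it agrees there with the
    -- global inverse `G`.
    refine (hinv.hasDerivAt.congr_of_eventuallyEq ?_).hasDerivWithinAt
    have hmemA : ∀ᶠ ξ in 𝓝 ζ, (hstrict (G ζ)).localInverse g _ _ hn0 ξ ∈ A := by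
      refine hct.eventually_mem ?_
      rw [hval]
      exact hAnhds _ (hGA _ hζ) hGζ
    filter_upwards [hri, hmemA, hΩ.mem_nhds hζ] with ξ h1 h2 h3
    conv_lhs => rw [← h1]
    exact hGl _ h2 (by rwa [h1])
  have hlip := hconv.norm_image_sub_le_of_norm_hasDerivWithin_le (C := 1 / 2) hderiv
    (fun ζ hζ => by
      rw [norm_inv, one_div]
      exact inv_anti₀ two_pos (hd _ (hGA _ hζ) (by rwa [hG _ hζ]))) hgz' hgz
  rw [hGl z hz hgz, hGl z' hz' hgz'] at hlip
  linarith

/-! ### Derivatives and symmetries of `f` -/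

/-- The primitive root of unity `ω_p = exp(2πi/p)`. -/
noncomputable def root (p : ℕ) : ℂ := Complex.exp (2 * Real.pi * Complex.I / p)

/-- The `j`-th derivative `∑ ω^{jk} exp(ω^k z)` of `f`. -/
noncomputable def fDeriv (p j : ℕ) (z : ℂ) : ℂ :=
  ∑ k ∈ Finset.range p, root p ^ (j * k) * Complex.exp (root p ^ k * z)

theorem fDeriv_zero (p : ℕ) : fDeriv p 0 = f p := by
  funext z
  simp [fDeriv, f, root]

theorem hasDerivAt_fDeriv (p j : ℕ) (z : ℂ) :
    HasDerivAt (fDeriv p j) (fDeriv p (j + 1) z) z := by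
  unfold fDeriv
  refine HasDerivAt.fun_sum fun k _ => ?_
  have h := (((hasDerivAt_id z).const_mul (root p ^ k)).cexp).const_mul (root p ^ (j * k))
  exact h.congr_deriv (by rw [id]; ring)

theorem root_eq (p : ℕ) : root p = Complex.exp ((2 * Real.pi / p : ℝ) * Complex.I) := by
  unfold root
  congr 1
  push_cast
  ring

theorem root_pow_eq (p k : ℕ) :
    root p ^ k = Complex.exp ((2 * k * (Real.pi / p) : ℝ) * Complex.I) := by
  rw [root_eq, ← Complex.exp_nat_mul]
  congr 1
  push_cast
  ring

theorem norm_root_pow (p k : ℕ) : ‖root p ^ k‖ = 1 := by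
  rw [root_pow_eq, Complex.norm_exp_ofReal_mul_I]

theorem root_ne_zero (p : ℕ) : root p ≠ 0 := Complex.exp_ne_zero _

theorem root_pow_self {p : ℕ} (hp : p ≠ 0) : root p ^ p = 1 :=
  (Complex.isPrimitiveRoot_exp p hp).pow_eq_one

theorem conj_root_pow (p k : ℕ) : (starRingEnd ℂ) (root p ^ k) = (root p ^ k)⁻¹ := by
  rw [Complex.inv_def, Complex.normSq_eq_norm_sq, norm_root_pow]
  simp

theorem re_root_pow (p k : ℕ) : (root p ^ k).re = Real.cos (2 * k * (Real.pi / p)) := by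
  rw [root_pow_eq, Complex.exp_ofReal_mul_I_re]

theorem im_root_pow (p k : ℕ) : (root p ^ k).im = Real.sin (2 * k * (Real.pi / p)) := by
  rw [root_pow_eq, Complex.exp_ofReal_mul_I_im]

/-- The map `z ↦ ω z̄` reflects in the line `y = tan(π/p) x` and exchanges the exponents with
indices `k` and `p - 1 - k` up to conjugation. The phase has modulus one, so `|f'|` is invariant
under the reflection. -/
theorem fDeriv_root_mul_conj {p : ℕ} (hp : p ≠ 0) (j : ℕ) (z : ℂ) :
    fDeriv p j (root p * (starRingEnd ℂ) z)
      = root p ^ (j * (p - 1)) * (starRingEnd ℂ) (fDeriv p j z) := by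
  unfold fDeriv
  rw [← Finset.sum_range_reflect, map_sum, Finset.mul_sum]
  refine Finset.sum_congr rfl fun k hk => ?_
  have hk' : k < p := Finset.mem_range.1 hk
  have h1 : root p ^ (p - 1 - k) * (root p * (starRingEnd ℂ) z)
      = (starRingEnd ℂ) (root p ^ k * z) := by
    rw [map_mul, conj_root_pow, ← mul_assoc, ← pow_succ]
    congr 1
    refine eq_inv_of_mul_eq_one_left ?_
    rw [← pow_add, show p - 1 - k + 1 + k = p by omega, root_pow_self hp]
  have h2 : root p ^ (j * (p - 1 - k)) = root p ^ (j * (p - 1)) * (root p ^ (j * k))⁻¹ := by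
    rw [eq_mul_inv_iff_mul_eq₀ (pow_ne_zero _ (root_ne_zero p)), ← pow_add, ← mul_add,
      Nat.sub_add_cancel (by omega)]
  rw [h1, h2, Complex.exp_conj, map_mul, conj_root_pow]
  ring

theorem f_root_mul_conj {p : ℕ} (hp : p ≠ 0) (z : ℂ) :
    f p (root p * (starRingEnd ℂ) z) = (starRingEnd ℂ) (f p z) := by
  simpa [fDeriv_zero] using fDeriv_root_mul_conj hp 0 z

theorem f_root_mul {p : ℕ} (hp : p ≠ 0) (z : ℂ) : f p (root p * z) = f p z := by
  have h1 := Finset.sum_range_succ (fun k => Complex.exp (root p ^ k * z)) p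
  have h2 := Finset.sum_range_succ' (fun k => Complex.exp (root p ^ k * z)) p
  rw [h2] at h1
  simp only [pow_zero, root_pow_self hp, add_left_inj] at h1
  change ∑ k ∈ Finset.range p, Complex.exp (root p ^ k * (root p * z)) =
    ∑ k ∈ Finset.range p, Complex.exp (root p ^ k * z)
  rw [← h1]
  simp only [pow_succ, mul_assoc]

theorem f_conj {p : ℕ} (hp : p ≠ 0) (z : ℂ) :
    f p ((starRingEnd ℂ) z) = (starRingEnd ℂ) (f p z) := by
  rw [← f_root_mul_conj hp, f_root_mul hp]

theorem differentiable_f (p : ℕ) : Differentiable ℂ (f p) := fun z => by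
  rw [← fDeriv_zero]
  exact (hasDerivAt_fDeriv p 0 z).differentiableAt

theorem deriv_f (p : ℕ) (z : ℂ) : deriv (f p) z = fDeriv p 1 z := by
  rw [← fDeriv_zero]
  exact (hasDerivAt_fDeriv p 0 z).deriv

/-! ### Dominant exponentials in the sector -/

/-- The closed upper half of the sector of half-angle `π/p` around the positive real axis,
without the real axis. -/
def sector (p : ℕ) : Set ℂ := {z | 0 < z.im ∧ z.im ≤ Real.tan (Real.pi / p) * z.re}

theorem pi_div_mem {p : ℕ} (hp : 3 ≤ p) : 0 < Real.pi / p ∧ Real.pi / p ≤ Real.pi / 3 := by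
  have hp' : (3 : ℝ) ≤ p := by exact_mod_cast hp
  exact ⟨by positivity, by gcongr⟩

theorem tan_pos {p : ℕ} (hp : 3 ≤ p) : 0 < Real.tan (Real.pi / p) := by
  obtain ⟨h1, h2⟩ := pi_div_mem hp
  exact Real.tan_pos_of_pos_of_lt_pi_div_two h1 (by linarith [Real.pi_pos])

theorem sin_pos {p : ℕ} (hp : 3 ≤ p) : 0 < Real.sin (Real.pi / p) := by
  obtain ⟨h1, h2⟩ := pi_div_mem hp
  exact Real.sin_pos_of_pos_of_lt_pi h1 (by linarith [Real.pi_pos])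

theorem cos_pos {p : ℕ} (hp : 3 ≤ p) : 0 < Real.cos (Real.pi / p) := by
  obtain ⟨h1, h2⟩ := pi_div_mem hp
  exact Real.cos_pos_of_mem_Ioo ⟨by linarith [Real.pi_pos], by linarith [Real.pi_pos]⟩

theorem re_pos_of_mem_sector {p : ℕ} (hp : 3 ≤ p) {z : ℂ} (hz : z ∈ sector p) : 0 < z.re :=
  pos_of_mul_pos_right (hz.1.trans_le hz.2) (tan_pos hp).le

theorem arg_mem_of_mem_sector {p : ℕ} (hp : 3 ≤ p) {z : ℂ} (hz : z ∈ sector p) :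
    0 ≤ z.arg ∧ z.arg ≤ Real.pi / p := by
  have hx := re_pos_of_mem_sector hp hz
  obtain ⟨h1, h2⟩ := pi_div_mem hp
  refine ⟨Complex.arg_nonneg_iff.2 hz.1.le, ?_⟩
  have h3 := abs_lt.1 (Complex.abs_arg_lt_pi_div_two_iff.2 (Or.inl hx))
  refine (Real.strictMonoOn_tan.le_iff_le ⟨h3.1, h3.2⟩
    ⟨by linarith [Real.pi_pos], by linarith [Real.pi_pos]⟩).1 ?_
  rw [Complex.tan_arg, div_le_iff₀ hx]
  exact hz.2

theorem re_root_pow_mul (p k : ℕ) (z : ℂ) :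
    (root p ^ k * z).re = ‖z‖ * Real.cos (2 * k * (Real.pi / p) + z.arg) := by
  rw [Complex.mul_re, re_root_pow, im_root_pow, Real.cos_add]
  conv_lhs => rw [← Complex.norm_mul_cos_arg z, ← Complex.norm_mul_sin_arg z]
  ring

theorem cos_le_cos_of_mem {s t : ℝ} (ht : 0 ≤ t) (h1 : t ≤ s) (h2 : s ≤ 2 * Real.pi - t) :
    Real.cos s ≤ Real.cos t := by
  rcases le_total s Real.pi with h | h
  · exact Real.cos_le_cos_of_nonneg_of_le_pi ht h h1
  · rw [← Real.cos_two_pi_sub s]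
    exact Real.cos_le_cos_of_nonneg_of_le_pi ht (by linarith) (by linarith)

theorem two_mul_nat_mul_le {p k l : ℕ} (hp : p ≠ 0) (h : k + l ≤ p) :
    2 * k * (Real.pi / p) ≤ 2 * Real.pi - 2 * l * (Real.pi / p) := by
  have h' : (k : ℝ) + l ≤ p := by exact_mod_cast h
  have h0 : (p : ℝ) ≠ 0 := by exact_mod_cast hp
  have : (0 : ℝ) ≤ Real.pi / p := by positivity
  have h3 : (p : ℝ) * (Real.pi / p) = Real.pi := by field_simp
  nlinarith [mul_le_mul_of_nonneg_right h' this]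

theorem re_root_pow_mul_le {p : ℕ} (hp : 3 ≤ p) {k : ℕ} (hk : k < p) {z : ℂ}
    (hz : z ∈ sector p) : (root p ^ k * z).re ≤ z.re := by
  obtain ⟨h1, h2⟩ := arg_mem_of_mem_sector hp hz
  obtain ⟨h3, h4⟩ := pi_div_mem hp
  rw [re_root_pow_mul, ← Complex.norm_mul_cos_arg z]
  refine mul_le_mul_of_nonneg_left (cos_le_cos_of_mem h1 ?_ ?_) (norm_nonneg _)
  · have : (0 : ℝ) ≤ 2 * k * (Real.pi / p) := by positivity
    linarith
  · have := two_mul_nat_mul_le (p := p) (k := k) (l := 1) (by omega) (by omega)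
    push_cast at this
    linarith

/-- The gap between the real parts of the two dominant exponents and the others. -/
noncomputable def gap (p : ℕ) : ℝ := Real.cos (Real.pi / p) - Real.cos (2 * (Real.pi / p))

theorem gap_pos {p : ℕ} (hp : 3 ≤ p) : 0 < gap p := by
  obtain ⟨h3, h4⟩ := pi_div_mem hp
  refine sub_pos.2 (Real.cos_lt_cos_of_nonneg_of_le_pi h3.le ?_ ?_) <;> linarith [Real.pi_pos]

/-- For these `k` the argument of `ω^k z` stays at least `2π/p` from the positive axis, while that
of `z` is at most `π/p`; the difference of the cosines is at least `gap p`. -/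
theorem re_root_pow_mul_le_sub {p : ℕ} (hp : 3 ≤ p) {k : ℕ} (hk0 : 1 ≤ k) (hk : k + 2 ≤ p) {z : ℂ}
    (hz : z ∈ sector p) : (root p ^ k * z).re ≤ z.re - gap p * ‖z‖ := by
  obtain ⟨h1, h2⟩ := arg_mem_of_mem_sector hp hz
  obtain ⟨h3, h4⟩ := pi_div_mem hp
  have hk0' : (1 : ℝ) ≤ k := by exact_mod_cast hk0
  have h5 : Real.cos (2 * k * (Real.pi / p) + z.arg) ≤ Real.cos (2 * (Real.pi / p)) := by
    refine cos_le_cos_of_mem (by linarith) ?_ ?_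
    · nlinarith
    · have := two_mul_nat_mul_le (p := p) (k := k) (l := 2) (by omega) hk
      push_cast at this
      linarith
  have h6 : Real.cos (Real.pi / p) ≤ Real.cos z.arg :=
    Real.cos_le_cos_of_nonneg_of_le_pi h1 (by linarith [Real.pi_pos]) h2
  rw [re_root_pow_mul, ← Complex.norm_mul_cos_arg z, gap]
  nlinarith [norm_nonneg z]

theorem norm_fDeriv_sub_le {p : ℕ} (hp : 3 ≤ p) (j : ℕ) {z : ℂ} (hz : z ∈ sector p) :
    ‖fDeriv p j z -
      (Complex.exp z + root p ^ (j * (p - 1)) * Complex.exp (root p ^ (p - 1) * z))‖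
      ≤ p * Real.exp (-(gap p * ‖z‖)) * Real.exp z.re := by
  obtain ⟨n, rfl⟩ : ∃ n, p = n + 2 := ⟨p - 2, by omega⟩
  have h : fDeriv (n + 2) j z - (Complex.exp z + root (n + 2) ^ (j * (n + 2 - 1)) *
      Complex.exp (root (n + 2) ^ (n + 2 - 1) * z)) = ∑ k ∈ Finset.range n,
      root (n + 2) ^ (j * (k + 1)) * Complex.exp (root (n + 2) ^ (k + 1) * z) := by
    unfold fDeriv
    rw [Finset.sum_range_succ, Finset.sum_range_succ']
    simp
  rw [h]
  calc _ ≤ ∑ k ∈ Finset.range n, Real.exp (z.re - gap (n + 2) * ‖z‖) := by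
        refine norm_sum_le_of_le _ fun k hk => ?_
        have hk' := Finset.mem_range.1 hk
        rw [norm_mul, norm_root_pow, one_mul, Complex.norm_exp]
        exact Real.exp_le_exp.2 (re_root_pow_mul_le_sub hp (by omega) (by omega) hz)
    _ = n * Real.exp (-(gap (n + 2) * ‖z‖)) * Real.exp z.re := by
        rw [Finset.sum_const, Finset.card_range, nsmul_eq_mul, mul_assoc, ← Real.exp_add]
        ring_nf
    _ ≤ _ := by
        gcongr
        simp

theorem norm_fDeriv_le {p : ℕ} (hp : 3 ≤ p) (j : ℕ) {z : ℂ} (hz : z ∈ sector p) :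
    ‖fDeriv p j z‖ ≤ p * Real.exp z.re := by
  calc _ ≤ ∑ k ∈ Finset.range p, Real.exp z.re := by
        refine norm_sum_le_of_le _ fun k hk => ?_
        rw [norm_mul, norm_root_pow, one_mul, Complex.norm_exp]
        exact Real.exp_le_exp.2 (re_root_pow_mul_le hp (Finset.mem_range.1 hk) hz)
    _ = _ := by simp

/-- The point `z + h` may leave the sector (it will be a reflection of `z`), so `exp (ω^k z)` is
factored out and only estimated at `z`. -/
theorem norm_f_add_sub_le {p : ℕ} (hp : 3 ≤ p) {z h : ℂ} (hz : z ∈ sector p) (hh : ‖h‖ ≤ 1) :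
    ‖f p (z + h) - f p z‖ ≤ 2 * p * Real.exp z.re * ‖h‖ := by
  rw [← fDeriv_zero]
  unfold fDeriv
  rw [← Finset.sum_sub_distrib]
  calc _ ≤ ∑ k ∈ Finset.range p, Real.exp z.re * (2 * ‖h‖) := by
        refine norm_sum_le_of_le _ fun k hk => ?_
        have hn : ‖root p ^ k * h‖ = ‖h‖ := by rw [norm_mul, norm_root_pow, one_mul]
        rw [mul_add, Complex.exp_add, ← mul_sub, ← mul_sub_one, norm_mul, norm_root_pow, one_mul,
          norm_mul, Complex.norm_exp]
        refine mul_le_mul (Real.exp_le_exp.2 (re_root_pow_mul_le hp (Finset.mem_range.1 hk) hz))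
          ?_ (norm_nonneg _) (Real.exp_pos _).le
        rw [← hn]
        exact Complex.norm_exp_sub_one_le (by rwa [hn])
    _ = _ := by
        rw [Finset.sum_const, Finset.card_range, nsmul_eq_mul]
        ring

theorem norm_fDeriv_add_sub_sub_le {p : ℕ} (hp : 3 ≤ p) (j : ℕ) {z h : ℂ} (hz : z ∈ sector p)
    (hh : ‖h‖ ≤ 1) :
    ‖fDeriv p j (z + h) - fDeriv p j z - h * fDeriv p (j + 1) z‖
      ≤ p * Real.exp z.re * ‖h‖ ^ 2 := by
  unfold fDeriv
  rw [Finset.mul_sum, ← Finset.sum_sub_distrib, ← Finset.sum_sub_distrib]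
  calc _ ≤ ∑ k ∈ Finset.range p, Real.exp z.re * ‖h‖ ^ 2 := by
        refine norm_sum_le_of_le _ fun k hk => ?_
        have hn : ‖root p ^ k * h‖ = ‖h‖ := by rw [norm_mul, norm_root_pow, one_mul]
        have he : root p ^ (j * k) * Complex.exp (root p ^ k * (z + h))
            - root p ^ (j * k) * Complex.exp (root p ^ k * z)
            - h * (root p ^ ((j + 1) * k) * Complex.exp (root p ^ k * z))
            = root p ^ (j * k) * (Complex.exp (root p ^ k * z)
              * (Complex.exp (root p ^ k * h) - 1 - root p ^ k * h)) := by
          rw [mul_add, Complex.exp_add]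
          ring
        rw [he, norm_mul, norm_root_pow, one_mul, norm_mul, Complex.norm_exp]
        refine mul_le_mul (Real.exp_le_exp.2 (re_root_pow_mul_le hp (Finset.mem_range.1 hk) hz))
          ?_ (norm_nonneg _) (Real.exp_pos _).le
        rw [← hn]
        exact Complex.norm_exp_sub_one_sub_id_le (by rwa [hn])
    _ = _ := by
        rw [Finset.sum_const, Finset.card_range, nsmul_eq_mul]
        ring

/-! ### Reflection in the slanted line -/

theorem root_pow_pred {p : ℕ} (hp : p ≠ 0) : root p ^ (p - 1) = (starRingEnd ℂ) (root p) := by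
  have h := conj_root_pow p 1
  rw [pow_one] at h
  rw [h]
  refine eq_inv_of_mul_eq_one_left ?_
  rw [← pow_succ, Nat.sub_add_cancel (by omega), root_pow_self hp]

theorem re_root (p : ℕ) : (root p).re = Real.cos (2 * (Real.pi / p)) := by
  simpa using re_root_pow p 1

theorem im_root (p : ℕ) : (root p).im = Real.sin (2 * (Real.pi / p)) := by
  simpa using im_root_pow p 1

/-- The imaginary part of `exp(-iπ/p) z`, the signed distance of `z` to the line
`y = tan(π/p) x`. -/
noncomputable def offset (p : ℕ) (z : ℂ) : ℝ :=
  Real.cos (Real.pi / p) * z.im - Real.sin (Real.pi / p) * z.re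

theorem offset_nonpos {p : ℕ} (hp : 3 ≤ p) {z : ℂ} (hz : z ∈ sector p) : offset p z ≤ 0 := by
  have h := hz.2
  have hc := cos_pos hp
  rw [Real.tan_eq_sin_div_cos, div_mul_eq_mul_div, le_div_iff₀ hc] at h
  unfold offset
  linarith

theorem re_root_pow_pred_mul {p : ℕ} (hp : p ≠ 0) (z : ℂ) :
    (root p ^ (p - 1) * z).re = z.re + 2 * Real.sin (Real.pi / p) * offset p z := by
  rw [root_pow_pred hp, Complex.mul_re, Complex.conj_re, Complex.conj_im, re_root, im_root,
    Real.sin_two_mul, Real.cos_two_mul', offset]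
  linear_combination z.re * Real.sin_sq_add_cos_sq (Real.pi / p)

theorem im_root_pow_pred_mul {p : ℕ} (hp : p ≠ 0) (z : ℂ) :
    (root p ^ (p - 1) * z).im = 2 * Real.cos (Real.pi / p) * offset p z - z.im := by
  rw [root_pow_pred hp, Complex.mul_im, Complex.conj_re, Complex.conj_im, re_root, im_root,
    Real.sin_two_mul, Real.cos_two_mul, offset]
  ring

theorem root_mul_conj_sub (p : ℕ) (z : ℂ) :
    root p * (starRingEnd ℂ) z - z = (2 * offset p z : ℝ) *
      (⟨Real.sin (Real.pi / p), -Real.cos (Real.pi / p)⟩ : ℂ) := by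
  have h := Real.sin_sq_add_cos_sq (Real.pi / p)
  apply Complex.ext
  · simp only [Complex.sub_re, Complex.mul_re, Complex.conj_re, Complex.conj_im, re_root, im_root,
      Real.sin_two_mul, Real.cos_two_mul', offset, Complex.ofReal_re, Complex.ofReal_im]
    linear_combination z.re * h
  · simp only [Complex.sub_im, Complex.mul_im, Complex.conj_re, Complex.conj_im, re_root, im_root,
      Real.sin_two_mul, Real.cos_two_mul, offset, Complex.ofReal_re, Complex.ofReal_im]
    ring

theorem norm_root_mul_conj_sub (p : ℕ) (z : ℂ) :
    ‖root p * (starRingEnd ℂ) z - z‖ = 2 * |offset p z| := by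
  rw [root_mul_conj_sub, norm_mul, Complex.norm_real, Complex.norm_eq_sqrt_sq_add_sq, neg_sq,
    Real.sin_sq_add_cos_sq, Real.sqrt_one, mul_one, Real.norm_eq_abs, abs_mul, abs_two]

theorem norm_one_sub_root_pow_pred {p : ℕ} (hp : 3 ≤ p) :
    ‖1 - root p ^ (p - 1)‖ = 2 * Real.sin (Real.pi / p) := by
  rw [root_pow_pred (by omega), Complex.norm_eq_sqrt_sq_add_sq, Real.sqrt_eq_iff_mul_self_eq
    (by positivity) (by linarith [sin_pos hp])]
  simp only [Complex.sub_re, Complex.sub_im, Complex.conj_re, Complex.conj_im, re_root, im_root,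
    Complex.one_re, Complex.one_im, Real.sin_two_mul, Real.cos_two_mul']
  have h := Real.sin_sq_add_cos_sq (Real.pi / p)
  have h' : Real.cos (Real.pi / p) ^ 2 = 1 - Real.sin (Real.pi / p) ^ 2 := by linarith
  simp only [h', mul_pow, sub_neg_eq_add, zero_add]
  ring

theorem div_tan_le_re {p : ℕ} (hp : 3 ≤ p) {z : ℂ} (hz : z ∈ sector p) :
    z.im / Real.tan (Real.pi / p) ≤ z.re := by
  rw [div_le_iff₀' (tan_pos hp)]
  exact hz.2

/-! ### Near-critical points and horizontal edges -/

theorem exists_error_le {p : ℕ} (hp : 3 ≤ p) {ε : ℝ} (hε : 0 < ε) :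
    ∃ Y : ℝ, ∀ z ∈ sector p, Y ≤ z.im →
      2 * Real.exp (-z.re) + p * Real.exp (-(gap p * ‖z‖)) ≤ ε := by
  have h1 : Tendsto (fun y : ℝ => 2 * Real.exp (-(y / Real.tan (Real.pi / p))) +
      p * Real.exp (-(gap p * y))) atTop (𝓝 (2 * 0 + p * 0)) := by
    refine Tendsto.add (Tendsto.const_mul _ ?_) (Tendsto.const_mul _ ?_)
    · exact Real.tendsto_exp_neg_atTop_nhds_zero.comp (tendsto_id.atTop_div_const (tan_pos hp))
    · exact Real.tendsto_exp_neg_atTop_nhds_zero.comp (tendsto_id.const_mul_atTop (gap_pos hp))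
  rw [mul_zero, mul_zero, add_zero] at h1
  obtain ⟨Y, hY⟩ := (h1.eventually (gt_mem_nhds hε)).exists_forall_of_atTop
  refine ⟨Y, fun z hz hzY => le_trans ?_ (hY _ hzY).le⟩
  have h2 := div_tan_le_re hp hz
  have h3 : z.im ≤ ‖z‖ := (le_abs_self _).trans (Complex.abs_im_le_norm z)
  have h4 := gap_pos hp
  gcongr

/-- Where `f'` is small the two dominant terms have nearly equal modulus, so `z` is near the axis,
and `f''` is of size `exp (re z)`. The reflected point `z + h` also has small derivative, so
Taylor's formula for `f'` bounds `exp (re z) * ‖h‖`. As `f (z + h)` is the conjugate of `f z`, this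
bounds `im (f z)`. -/
theorem exists_abs_im_f_le {p : ℕ} (hp : 3 ≤ p) :
    ∃ Y : ℝ, ∀ z ∈ sector p, Y ≤ z.im → ‖fDeriv p 1 z‖ < 2 →
      |(f p z).im| ≤ 4 * p / Real.sin (Real.pi / p) := by
  have hp0 : p ≠ 0 := by omega
  have hpR : (3 : ℝ) ≤ p := by exact_mod_cast hp
  have hb := sin_pos hp
  have hb1 := Real.sin_le_one (Real.pi / p)
  set b := Real.sin (Real.pi / p) with hbdef
  -- With `‖h‖ ≤ 2δ` the quadratic Taylor error `p X ‖h‖²` is at most `X ‖h‖ b / 2`.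
  set δ : ℝ := b / (4 * p) with hδ
  have hδ0 : 0 < δ := by positivity
  have hδ1 : 2 * δ ≤ 1 := by
    rw [hδ, mul_div_assoc', div_le_one (by positivity)]
    linarith
  have hE1 : Real.exp (-(2 * b * δ)) < 1 := Real.exp_lt_one_iff.2 (by
    have : 0 < 2 * b * δ := by positivity
    linarith)
  -- The first bound keeps `2b - 2η ≥ 3b/2` in the estimate of `f''`; the second contradicts
  -- `|offset p z| > δ`.
  obtain ⟨Y, hY⟩ := exists_error_le hp
    (ε := min (b / 4) ((1 - Real.exp (-(2 * b * δ))) / 2)) (lt_min (by positivity) (by linarith))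
  refine ⟨Y, fun z hz hzY hsmall => ?_⟩
  have herr := hY z hz hzY
  have hM0 := norm_fDeriv_sub_le hp 1 hz
  have hM1 := norm_fDeriv_sub_le hp 2 hz
  set E : ℝ := p * Real.exp (-(gap p * ‖z‖)) with hE
  have hE0 : 0 ≤ E := by positivity
  set X := Real.exp z.re with hX
  have hX0 : 0 < X := Real.exp_pos _
  set η := 2 * Real.exp (-z.re) + E with hη
  have hη1 : η ≤ b / 4 := herr.trans (min_le_left _ _)
  have hη2 : η ≤ (1 - Real.exp (-(2 * b * δ))) / 2 := herr.trans (min_le_right _ _)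
  have hηX : 2 + E * X = η * X := by
    have : Real.exp (-z.re) * X = 1 := by rw [hX, ← Real.exp_add, neg_add_cancel, Real.exp_zero]
    rw [hη]
    linear_combination -2 * this
  have hEη : E ≤ η := by
    rw [hη]
    linarith [Real.exp_pos (-z.re)]
  set r := root p ^ (p - 1) with hr
  have hr1 : ‖r‖ = 1 := norm_root_pow _ _
  have hrr1 : root p ^ (1 * (p - 1)) = r := by rw [one_mul]
  have hrr2 : root p ^ (2 * (p - 1)) = r * r := by rw [two_mul, pow_add]
  rw [hrr1] at hM0
  rw [hrr2] at hM1
  set Q := Complex.exp (r * z) with hQ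
  have hS : ‖Complex.exp z + r * Q‖ ≤ η * X := by
    have := norm_sub_norm_le (Complex.exp z + r * Q) (fDeriv p 1 z)
    rw [norm_sub_rev] at this
    linarith
  have hexpz : ‖Complex.exp z‖ = X := Complex.norm_exp z
  -- the offset is small
  have hQn : ‖Q‖ = X * Real.exp (2 * b * offset p z) := by
    rw [hQ, Complex.norm_exp, hr, re_root_pow_pred_mul hp0, Real.exp_add]
  have hv0 := offset_nonpos hp hz
  have hv : |offset p z| ≤ δ := by
    rw [abs_of_nonpos hv0]
    by_contra! hcon
    have h1 : Real.exp (2 * b * offset p z) ≤ Real.exp (-(2 * b * δ)) :=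
      Real.exp_le_exp.2 (by nlinarith)
    have h2 : X - ‖Q‖ ≤ η * X := by
      have h3 := norm_sub_norm_le (Complex.exp z) (-(r * Q))
      rw [sub_neg_eq_add, norm_neg, norm_mul, hr1, one_mul, hexpz] at h3
      linarith
    rw [hQn] at h2
    nlinarith
  -- the second derivative is large
  have hD2 : X * (2 * b - 2 * η) ≤ ‖fDeriv p 2 z‖ := by
    -- Subtracting `r` times the small main part of `f'` eliminates `Q` from the main part of `f''`.
    have h1 : Complex.exp z * (1 - r) = fDeriv p 2 z
        - (fDeriv p 2 z - (Complex.exp z + r * r * Q)) - r * (Complex.exp z + r * Q) := by ring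
    have h2 := congrArg norm h1
    rw [norm_mul, hexpz, norm_one_sub_root_pow_pred hp] at h2
    have h3 := norm_sub_le (fDeriv p 2 z - (fDeriv p 2 z - (Complex.exp z + r * r * Q)))
      (r * (Complex.exp z + r * Q))
    have h4 := norm_sub_le (fDeriv p 2 z) (fDeriv p 2 z - (Complex.exp z + r * r * Q))
    rw [norm_mul, hr1, one_mul] at h3
    nlinarith
  set h := root p * (starRingEnd ℂ) z - z with hh
  have hhn : ‖h‖ = 2 * |offset p z| := norm_root_mul_conj_sub p z
  have hzh : z + h = root p * (starRingEnd ℂ) z := by rw [hh]; ring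
  have hh1 : ‖h‖ ≤ 1 := by linarith
  have hT := norm_fDeriv_add_sub_sub_le hp 1 hz hh1
  have hsmall' : ‖fDeriv p 1 (z + h)‖ < 2 := by
    rw [hzh, fDeriv_root_mul_conj hp0, norm_mul, norm_root_pow, one_mul, Complex.norm_conj]
    exact hsmall
  have hXh : X * ‖h‖ * b ≤ 4 := by
    have h1 := norm_sub_norm_le (h * fDeriv p 2 z) (fDeriv p 1 (z + h) - fDeriv p 1 z)
    rw [norm_sub_rev (h * fDeriv p 2 z), norm_mul] at h1
    have h2 := norm_sub_le (fDeriv p 1 (z + h)) (fDeriv p 1 z)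
    have h3 : X * ‖h‖ * (2 * b - 2 * η) ≤ ‖h‖ * ‖fDeriv p 2 z‖ := by
      rw [mul_comm X, mul_assoc]
      exact mul_le_mul_of_nonneg_left hD2 (norm_nonneg _)
    have h4 : p * X * ‖h‖ ^ 2 ≤ X * ‖h‖ * (b / 2) := by
      have h5 : p * ‖h‖ ≤ b / 2 := by
        have h6 : ‖h‖ ≤ 2 * δ := by linarith
        calc p * ‖h‖ ≤ p * (2 * δ) := by gcongr
          _ = b / 2 := by rw [hδ]; field_simp; norm_num
      calc p * X * ‖h‖ ^ 2 = X * ‖h‖ * (p * ‖h‖) := by ring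
        _ ≤ _ := by gcongr
    have h7 : X * ‖h‖ * (2 * b - 2 * η) ≥ X * ‖h‖ * (3 / 2 * b) := by
      gcongr
      linarith
    have hT' : ‖fDeriv p 1 (z + h) - fDeriv p 1 z - h * fDeriv p 2 z‖ ≤ p * X * ‖h‖ ^ 2 := hT
    linarith
  have hF := norm_f_add_sub_le hp hz hh1
  rw [hzh, f_root_mul_conj hp0] at hF
  have hF' : ‖(starRingEnd ℂ) (f p z) - f p z‖ = 2 * |(f p z).im| := by
    have : (starRingEnd ℂ) (f p z) - f p z = ((-2 * (f p z).im : ℝ) : ℂ) * Complex.I := by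
      apply Complex.ext <;> simp
      ring
    rw [this, norm_mul, Complex.norm_I, mul_one, Complex.norm_real, Real.norm_eq_abs, abs_mul]
    norm_num
  rw [hF'] at hF
  rw [le_div_iff₀ hb]
  have h9 : 2 * |(f p z).im| * b ≤ 2 * p * X * ‖h‖ * b := mul_le_mul_of_nonneg_right hF hb.le
  have h10 : 2 * p * X * ‖h‖ * b ≤ 2 * p * 4 := by
    calc 2 * p * X * ‖h‖ * b = 2 * p * (X * ‖h‖ * b) := by ring
      _ ≤ _ := by gcongr
  linarith

theorem im_f_eq_zero_of_im_eq {p : ℕ} (hp : 3 ≤ p) {z : ℂ}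
    (hz : z.im = Real.tan (Real.pi / p) * z.re) : (f p z).im = 0 := by
  have hc := cos_pos hp
  have hv : offset p z = 0 := by
    rw [offset, hz, Real.tan_eq_sin_div_cos]
    field_simp
    ring
  have h1 : root p * (starRingEnd ℂ) z = z := by
    rw [← sub_eq_zero, root_mul_conj_sub, hv]
    simp
  have h2 := f_root_mul_conj (p := p) (by omega) z
  rw [h1] at h2
  exact Complex.conj_eq_iff_im.1 h2.symm

theorem exists_re_f_nonpos {p : ℕ} (hp : 3 ≤ p) :
    ∃ Y : ℝ, ∀ z ∈ sector p, Y ≤ z.im → (∃ n : ℤ, z.im = Real.pi + n * (2 * Real.pi)) →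
      (f p z).re ≤ 0 := by
  have hp0 : p ≠ 0 := by omega
  have ha := cos_pos hp
  have hb := sin_pos hp
  set a := Real.cos (Real.pi / p) with hadef
  set b := Real.sin (Real.pi / p) with hbdef
  have hlt : Real.exp (-(b * Real.pi / (2 * a))) < 1 := by
    refine Real.exp_lt_one_iff.2 (neg_lt_zero.2 ?_)
    have := Real.pi_pos
    positivity
  obtain ⟨Y, hY⟩ := exists_error_le hp
    (ε := 1 - Real.exp (-(b * Real.pi / (2 * a)))) (by linarith)
  refine ⟨Y, fun z hz hzY ⟨n, hn⟩ => ?_⟩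
  have herr := hY z hz hzY
  have hM := norm_fDeriv_sub_le hp 0 hz
  have hv := offset_nonpos hp hz
  rw [zero_mul, pow_zero, one_mul, fDeriv_zero] at hM
  have hre := (Complex.re_le_norm _).trans hM
  rw [Complex.sub_re, Complex.add_re, Complex.exp_re z, Complex.exp_re (_ * z),
    re_root_pow_pred_mul hp0, im_root_pow_pred_mul hp0, Real.exp_add, ← hadef, ← hbdef] at hre
  have hc1 : Real.cos z.im = -1 := by
    rw [hn, Real.cos_add_int_mul_two_pi, Real.cos_pi]
  have hs1 : Real.sin z.im = 0 := by
    rw [hn, Real.sin_add_int_mul_two_pi, Real.sin_pi]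
  rw [Real.cos_sub, hc1, hs1] at hre
  set v := offset p z
  have hX := Real.exp_pos z.re
  -- Here `exp z` is `-exp (re z)`. The other dominant term has nonpositive real part while `2av ≥
  -- -π/2`; beyond that, its modulus is smaller by a fixed factor.
  have key : Real.exp (2 * b * v) * -Real.cos (2 * a * v) ≤ Real.exp (-(b * Real.pi / (2 * a))) := by
    rcases le_or_gt (-(Real.pi / 2)) (2 * a * v) with h | h
    · have h1 : 0 ≤ Real.cos (2 * a * v) := by
        refine Real.cos_nonneg_of_mem_Icc ⟨h, ?_⟩
        have : 2 * a * v ≤ 0 := mul_nonpos_of_nonneg_of_nonpos (by positivity) hv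
        linarith [Real.pi_pos]
      have := Real.exp_pos (2 * b * v)
      have := Real.exp_pos (-(b * Real.pi / (2 * a)))
      nlinarith
    · have h1 : Real.exp (2 * b * v) ≤ Real.exp (-(b * Real.pi / (2 * a))) := by
        refine Real.exp_le_exp.2 ?_
        have h2 : b / a * (2 * a * v) ≤ b / a * (-(Real.pi / 2)) :=
          mul_le_mul_of_nonneg_left h.le (by positivity)
        calc 2 * b * v = b / a * (2 * a * v) := by field_simp
          _ ≤ _ := h2
          _ = _ := by field_simp
      have h2 := Real.neg_one_le_cos (2 * a * v)
      have := Real.exp_pos (2 * b * v)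
      nlinarith
  have h0 := Real.exp_pos (-z.re)
  have hE : (p : ℝ) * Real.exp (-(gap p * ‖z‖)) * Real.exp z.re
      ≤ (1 - Real.exp (-(b * Real.pi / (2 * a)))) * Real.exp z.re := by
    gcongr
    linarith
  nlinarith

/-! ### Comparison with `exp` far to the right -/

/-- The relative error of the approximation `f(z) ≈ exp z`. -/
noncomputable def tail (p : ℕ) (z : ℂ) : ℂ :=
  ∑ k ∈ Finset.range (p - 1), Complex.exp ((root p ^ (k + 1) - 1) * z)

theorem f_eq_exp_mul {p : ℕ} (hp : p ≠ 0) (z : ℂ) : f p z = Complex.exp z * (1 + tail p z) := by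
  obtain ⟨n, rfl⟩ : ∃ n, p = n + 1 := ⟨p - 1, by omega⟩
  have h : f (n + 1) z = ∑ k ∈ Finset.range (n + 1), Complex.exp (root (n + 1) ^ k * z) := rfl
  rw [h, Finset.sum_range_succ', tail, mul_add, Finset.mul_sum, add_comm]
  simp only [← Complex.exp_add, Nat.add_sub_cancel]
  congr 1
  · simp
  · refine Finset.sum_congr rfl fun k _ => ?_
    congr 1
    ring

theorem hasDerivAt_tail (p : ℕ) (z : ℂ) :
    HasDerivAt (tail p) (∑ k ∈ Finset.range (p - 1),
      Complex.exp ((root p ^ (k + 1) - 1) * z) * (root p ^ (k + 1) - 1)) z := by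
  unfold tail
  refine HasDerivAt.fun_sum fun k _ => ?_
  have h := ((hasDerivAt_id z).const_mul (root p ^ (k + 1) - 1)).cexp
  exact h.congr_deriv (by rw [id]; ring)

theorem norm_exp_root_pow_sub_one_mul_le {p : ℕ} (hp : 3 ≤ p) {k : ℕ} (hk : k + 1 < p) {z : ℂ}
    {Y : ℝ} (hx : 0 ≤ z.re) (hy : |z.im| ≤ Y) :
    ‖Complex.exp ((root p ^ (k + 1) - 1) * z)‖
      ≤ Real.exp (Y - (1 - Real.cos (2 * (Real.pi / p))) * z.re) := by
  obtain ⟨h1, h2⟩ := pi_div_mem hp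
  rw [Complex.norm_exp]
  refine Real.exp_le_exp.2 ?_
  rw [Complex.mul_re, Complex.sub_re, Complex.sub_im, re_root_pow, im_root_pow, Complex.one_re,
    Complex.one_im, sub_zero]
  have hc : Real.cos (2 * (k + 1 : ℕ) * (Real.pi / p)) ≤ Real.cos (2 * (Real.pi / p)) := by
    refine cos_le_cos_of_mem (by positivity) ?_ ?_
    · have hk0 : (1 : ℝ) ≤ (k + 1 : ℕ) := by
        push_cast
        linarith [Nat.cast_nonneg (α := ℝ) k]
      nlinarith
    · have := two_mul_nat_mul_le (p := p) (k := k + 1) (l := 1) (by omega) (by omega)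
      simpa using this
  have hs : -(Real.sin (2 * (k + 1 : ℕ) * (Real.pi / p)) * z.im) ≤ Y := by
    refine (neg_le_abs _).trans ?_
    rw [abs_mul]
    have := Real.abs_sin_le_one (2 * (k + 1 : ℕ) * (Real.pi / p))
    have := abs_nonneg z.im
    nlinarith
  nlinarith

theorem exists_tail_small {p : ℕ} (hp : 3 ≤ p) (Y : ℝ) {η : ℝ} (hη : 0 < η) :
    ∃ c₁ : ℝ, (∀ z : ℂ, c₁ ≤ z.re → |z.im| ≤ Y → ‖tail p z‖ ≤ η) ∧
      ∀ z z' : ℂ, c₁ ≤ z.re → |z.im| ≤ Y → c₁ ≤ z'.re → |z'.im| ≤ Y →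
        ‖tail p z - tail p z'‖ ≤ η * ‖z - z'‖ := by
  obtain ⟨h1, h2⟩ := pi_div_mem hp
  have hμ : 0 < 1 - Real.cos (2 * (Real.pi / p)) := by
    have := Real.cos_lt_cos_of_nonneg_of_le_pi le_rfl
      (by linarith [Real.pi_pos] : 2 * (Real.pi / p) ≤ Real.pi) (by positivity)
    rw [Real.cos_zero] at this
    linarith
  have hlim : Tendsto (fun x : ℝ => p * (2 * Real.exp (Y - (1 - Real.cos (2 * (Real.pi / p))) * x)))
      atTop (𝓝 (p * (2 * 0))) := by
    refine Tendsto.const_mul _ (Tendsto.const_mul _ (Real.tendsto_exp_atBot.comp ?_))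
    exact tendsto_atBot_add_const_left _ _
      (tendsto_neg_atTop_atBot.comp (tendsto_id.const_mul_atTop hμ))
  rw [mul_zero, mul_zero] at hlim
  obtain ⟨c₁, hc₁⟩ := (hlim.eventually (gt_mem_nhds hη)).exists_forall_of_atTop
  have hbound : ∀ z : ℂ, max c₁ 0 ≤ z.re → |z.im| ≤ Y → ∀ k ∈ Finset.range (p - 1),
      ‖Complex.exp ((root p ^ (k + 1) - 1) * z)‖
        ≤ Real.exp (Y - (1 - Real.cos (2 * (Real.pi / p))) * z.re) := fun z hx hy k hk =>
    norm_exp_root_pow_sub_one_mul_le hp (by have := Finset.mem_range.1 hk; omega)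
      ((le_max_right _ _).trans hx) hy
  have hcard : ∀ t : ℝ, 0 ≤ t → ((p - 1 : ℕ) : ℝ) * t ≤ p * t := fun t ht =>
    mul_le_mul_of_nonneg_right (by exact_mod_cast Nat.sub_le p 1) ht
  refine ⟨max c₁ 0, fun z hx hy => ?_, fun z z' hx hy hx' hy' => ?_⟩
  · refine (norm_sum_le_of_le _ (hbound z hx hy)).trans ?_
    rw [Finset.sum_const, Finset.card_range, nsmul_eq_mul]
    have h3 := hc₁ z.re ((le_max_left _ _).trans hx)
    have h4 := Real.exp_pos (Y - (1 - Real.cos (2 * (Real.pi / p))) * z.re)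
    refine (hcard _ h4.le).trans (le_trans ?_ h3.le)
    gcongr
    linarith
  · let H : Set ℂ := {w | max c₁ 0 ≤ w.re} ∩ ({w | -Y ≤ w.im} ∩ {w | w.im ≤ Y})
    have hH : Convex ℝ H := (convex_halfSpace_re_ge _).inter
      ((convex_halfSpace_im_ge _).inter (convex_halfSpace_im_le _))
    refine hH.norm_image_sub_le_of_norm_hasDerivWithin_le
      (fun w _ => (hasDerivAt_tail p w).hasDerivWithinAt) (fun w hw => ?_)
      ⟨hx', abs_le.1 hy'⟩ ⟨hx, abs_le.1 hy⟩
    have hwY : |w.im| ≤ Y := abs_le.2 hw.2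
    have h3 := hc₁ w.re ((le_max_left _ _).trans hw.1)
    have h4 := Real.exp_pos (Y - (1 - Real.cos (2 * (Real.pi / p))) * w.re)
    have h5 : ∀ k ∈ Finset.range (p - 1),
        ‖Complex.exp ((root p ^ (k + 1) - 1) * w) * (root p ^ (k + 1) - 1)‖
          ≤ 2 * Real.exp (Y - (1 - Real.cos (2 * (Real.pi / p))) * w.re) := fun k hk => by
      rw [norm_mul, mul_comm]
      refine mul_le_mul ?_ (hbound w hw.1 hwY k hk) (norm_nonneg _) two_pos.le
      refine (norm_sub_le _ _).trans ?_
      rw [norm_root_pow, norm_one]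
      norm_num
    refine (norm_sum_le_of_le _ h5).trans ?_
    rw [Finset.sum_const, Finset.card_range, nsmul_eq_mul]
    exact (hcard _ (by positivity)).trans h3.le

/-- Closeness of `exp d` to `1` forces `cos (im d) > 0`, hence `|im d| < π/2`, and `d` is the
principal logarithm of `exp d`. Then `|log (1 + w)| ≤ 3|w|/2` gives `‖d‖ ≤ 3‖d‖/4`. -/
theorem eq_of_exp_sub_one_small {d : ℂ} (him : |d.im| < 3 * Real.pi / 2)
    (h1 : ‖Complex.exp d - 1‖ ≤ 1 / 2) (h2 : ‖Complex.exp d - 1‖ ≤ ‖d‖ / 2) : d = 0 := by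
  have hre : 0 < (Complex.exp d).re := by
    have := (Complex.abs_re_le_norm (Complex.exp d - 1)).trans h1
    rw [Complex.sub_re, Complex.one_re] at this
    linarith [(abs_le.1 this).1]
  rw [Complex.exp_re] at hre
  have hcos : 0 < Real.cos d.im := pos_of_mul_pos_right hre (Real.exp_pos _).le
  have him' : |d.im| < Real.pi / 2 := by
    by_contra! hcon
    have := Real.cos_nonpos_of_pi_div_two_le_of_le hcon (by linarith)
    rw [Real.cos_abs] at this
    linarith
  have hlog : Complex.log (1 + (Complex.exp d - 1)) = d := by
    rw [add_sub_cancel]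
    have := abs_lt.1 him'
    exact Complex.log_exp (by linarith [Real.pi_pos]) (by linarith [Real.pi_pos])
  have h3 := Complex.norm_log_one_add_half_le_self h1
  rw [hlog] at h3
  have : ‖d‖ ≤ 0 := by linarith
  exact norm_le_zero_iff.1 this

/-! ### Covering and expansion for one trapezium -/

/-- The convex region that contains all trapeziums above (`s = 1`) or below (`s = -1`) the real
axis. -/
def halfRegion (B R s : ℝ) : Set ℂ := {ζ | 0 < ζ.re ∧ B < s * ζ.im ∧ ‖ζ‖ < R}

theorem isOpen_halfRegion (B R s : ℝ) : IsOpen (halfRegion B R s) :=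
  (isOpen_lt continuous_const Complex.continuous_re).inter
    ((isOpen_lt continuous_const (continuous_const.mul Complex.continuous_im)).inter
      (isOpen_lt continuous_norm continuous_const))

theorem convex_halfRegion (B R s : ℝ) : Convex ℝ (halfRegion B R s) := by
  refine (convex_halfSpace_re_gt 0).inter (Convex.inter ?_ ?_)
  · exact convex_halfSpace_gt (f := fun ζ : ℂ => s * ζ.im)
      ⟨fun x y => by simp [mul_add], fun r x => by simp; ring⟩ B
  · have h : {ζ : ℂ | ‖ζ‖ < R} = Metric.ball 0 R := by
      ext ζ
      simp
    change Convex ℝ {ζ : ℂ | ‖ζ‖ < R}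
    rw [h]
    exact convex_ball _ _

theorem isCompact_trapezium {p : ℕ} (hp : 3 ≤ p) (m : ℕ) (c : ℝ) :
    IsCompact (trapezium p m c) := by
  have ht := tan_pos hp
  have hsub : trapezium p m c ⊆
      Icc (((2 * (m : ℝ) - 1) * Real.pi) / Real.tan (Real.pi / p)) c ×ℂ
        Icc ((2 * (m : ℝ) - 1) * Real.pi) ((2 * (m : ℝ) + 1) * Real.pi) := by
    rintro z ⟨h1, h2, h3, h4⟩
    refine ⟨⟨?_, h4⟩, h1, h2⟩
    rw [div_le_iff₀' ht]
    linarith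
  refine (isCompact_Icc.reProdIm isCompact_Icc).of_isClosed_subset ?_ hsub
  exact (isClosed_le continuous_const Complex.continuous_im).inter
    ((isClosed_le Complex.continuous_im continuous_const).inter
      ((isClosed_le Complex.continuous_im (continuous_const.mul Complex.continuous_re)).inter
        (isClosed_le Complex.continuous_re continuous_const)))

theorem le_bottom {m : ℕ} (hm : 1 ≤ m) : (m : ℝ) ≤ (2 * (m : ℝ) - 1) * Real.pi := by
  have hm' : (1 : ℝ) ≤ m := by exact_mod_cast hm
  nlinarith [Real.pi_gt_three]

theorem trapezium_subset_sector {p m : ℕ} (hm : 1 ≤ m) (c : ℝ) :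
    trapezium p m c ⊆ sector p := by
  rintro z ⟨h1, -, h3, -⟩
  have hm' : (1 : ℝ) ≤ m := by exact_mod_cast hm
  exact ⟨by linarith [le_bottom hm], h3⟩

theorem norm_f_bounds {p : ℕ} (hp : p ≠ 0) {z : ℂ} (hz : ‖tail p z‖ ≤ 1 / 8) :
    7 / 8 * Real.exp z.re ≤ ‖f p z‖ ∧ ‖f p z‖ ≤ 9 / 8 * Real.exp z.re := by
  rw [f_eq_exp_mul hp, norm_mul, Complex.norm_exp]
  have h1 := norm_add_le 1 (tail p z)
  have h2 := norm_sub_le (1 + tail p z) (tail p z)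
  rw [add_sub_cancel_right] at h2
  rw [norm_one] at h1 h2
  have := Real.exp_pos z.re
  constructor <;> nlinarith

theorem trapezium_covers_and_expands {p : ℕ} (hp : 3 ≤ p) {m : ℕ} (hm : 1 ≤ m) {B c c₁ s : ℝ}
    (hs : s = 1 ∨ s = -1) (hB : 0 ≤ B)
    (hder : ∀ z ∈ sector p, (m : ℝ) ≤ z.im → ‖fDeriv p 1 z‖ < 2 → |(f p z).im| ≤ B)
    (hedge : ∀ z ∈ sector p, (m : ℝ) ≤ z.im → (∃ n : ℤ, z.im = Real.pi + n * (2 * Real.pi)) →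
      (f p z).re ≤ 0)
    (htail : ∀ z : ℂ, c₁ ≤ z.re → |z.im| ≤ (2 * (m : ℝ) + 1) * Real.pi → ‖tail p z‖ ≤ 1 / 8)
    (htail' : ∀ z z' : ℂ, c₁ ≤ z.re → |z.im| ≤ (2 * (m : ℝ) + 1) * Real.pi → c₁ ≤ z'.re →
      |z'.im| ≤ (2 * (m : ℝ) + 1) * Real.pi → ‖tail p z - tail p z'‖ ≤ 1 / 8 * ‖z - z'‖)
    (hc₁ : c₁ + 1 + Real.log (2 * p) ≤ c)
    (hct : (2 * (m : ℝ) + 1) * Real.pi ≤ Real.tan (Real.pi / p) * (c - 1))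
    (hcB : B < Real.exp (c - 1) / 2) :
    halfRegion B (Real.exp c / 2) s ⊆ f p '' trapezium p m c ∧
    (∀ z ∈ trapezium p m c, ∀ z' ∈ trapezium p m c, f p z ∈ halfRegion B (Real.exp c / 2) s →
      f p z' ∈ halfRegion B (Real.exp c / 2) s → 2 * ‖z - z'‖ ≤ ‖f p z - f p z'‖) ∧
    ∀ z ∈ trapezium p m c, f p z ∈ halfRegion B (Real.exp c / 2) s →
      (2 * (m : ℝ) - 1) * Real.pi < z.im ∧ z.im < (2 * (m : ℝ) + 1) * Real.pi := by
  have hp0 : p ≠ 0 := by omega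
  have hpR : (3 : ℝ) ≤ p := by exact_mod_cast hp
  have hm' : (1 : ℝ) ≤ m := by exact_mod_cast hm
  have hbot := le_bottom hm
  have hπ := Real.pi_pos
  have hlogp : 0 ≤ Real.log (2 * p) := Real.log_nonneg (by linarith)
  have hs1 : |s| = 1 := by rcases hs with rfl | rfl <;> simp
  let U : Set ℂ := {z | (2 * (m : ℝ) - 1) * Real.pi < z.im ∧ z.im < (2 * (m : ℝ) + 1) * Real.pi ∧
    z.im < Real.tan (Real.pi / p) * z.re ∧ z.re < c}
  have hU : IsOpen U :=
    (isOpen_lt continuous_const Complex.continuous_im).inter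
      ((isOpen_lt Complex.continuous_im continuous_const).inter
        ((isOpen_lt Complex.continuous_im (continuous_const.mul Complex.continuous_re)).inter
          (isOpen_lt Complex.continuous_re continuous_const)))
  have habs : ∀ z ∈ trapezium p m c, |z.im| ≤ (2 * (m : ℝ) + 1) * Real.pi := fun z hz => by
    rw [abs_of_pos (trapezium_subset_sector hm c hz).1]
    exact hz.2.1
  have hexpand : ∀ z : ℂ, ‖tail p z‖ ≤ 1 / 8 → 7 / 8 * Real.exp z.re ≤ ‖f p z‖ ∧
      ‖f p z‖ ≤ 9 / 8 * Real.exp z.re := fun z => norm_f_bounds hp0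
  have hbdry : ∀ z ∈ trapezium p m c, f p z ∈ halfRegion B (Real.exp c / 2) s → z ∈ U := by
    rintro z hz ⟨hf1, hf2, hf3⟩
    have hsec := trapezium_subset_sector hm c hz
    obtain ⟨h1, h2, h3, h4⟩ := hz
    refine ⟨lt_of_le_of_ne h1 fun h => ?_, lt_of_le_of_ne h2 fun h => ?_,
      lt_of_le_of_ne h3 fun h => ?_, lt_of_le_of_ne h4 fun h => ?_⟩
    · have := hedge z hsec (by linarith) ⟨m - 1, by rw [← h]; push_cast; ring⟩
      linarith
    · have := hedge z hsec (by linarith) ⟨m, by rw [h]; push_cast; ring⟩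
      linarith
    · rw [im_f_eq_zero_of_im_eq hp h, mul_zero] at hf2
      linarith
    · have := (hexpand z (htail z (by rw [h]; linarith) (by rw [abs_of_pos hsec.1]; exact h2))).1
      rw [h] at this
      linarith [Real.exp_pos c]
  have hd : ∀ z ∈ trapezium p m c, f p z ∈ halfRegion B (Real.exp c / 2) s →
      2 ≤ ‖deriv (f p) z‖ := by
    rintro z hz ⟨-, hf2, -⟩
    by_contra! hcon
    rw [deriv_f] at hcon
    have h1 := hder z (trapezium_subset_sector hm c hz) (by linarith [hz.1]) hcon
    have h2 := le_abs_self (s * (f p z).im)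
    rw [abs_mul, hs1, one_mul] at h2
    linarith
  -- `exp z₀` has argument `±π/4` and modulus `e^(c-1)`; since `9/8 < e/2`, the value `f z₀` is
  -- within the radius `e^c / 2`.
  let z₀ : ℂ := ⟨c - 1, 2 * m * Real.pi + s * (Real.pi / 4)⟩
  have hz₀re : z₀.re = c - 1 := rfl
  have hz₀im : z₀.im = 2 * m * Real.pi + s * (Real.pi / 4) := rfl
  have hsπ : -(Real.pi / 4) ≤ s * (Real.pi / 4) ∧ s * (Real.pi / 4) ≤ Real.pi / 4 := by
    rw [← abs_le, abs_mul, hs1, one_mul, abs_of_pos (by positivity)]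
  have hz₀ : z₀ ∈ trapezium p m c := by
    obtain ⟨hsπ1, hsπ2⟩ := hsπ
    refine ⟨?_, ?_, ?_, ?_⟩
    · rw [hz₀im]; linarith
    · rw [hz₀im]; linarith
    · rw [hz₀im, hz₀re]; linarith
    · rw [hz₀re]; linarith
  have ht₀ : ‖tail p z₀‖ ≤ 1 / 8 := htail z₀ (by rw [hz₀re]; linarith) (habs z₀ hz₀)
  have hX := Real.exp_pos (c - 1)
  have hcX : Real.exp c = Real.exp 1 * Real.exp (c - 1) := by
    rw [← Real.exp_add]
    ring_nf
  have hf₀ : f p z₀ ∈ halfRegion B (Real.exp c / 2) s := by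
    have hdiff : ‖f p z₀ - Complex.exp z₀‖ ≤ 1 / 8 * Real.exp (c - 1) := by
      rw [f_eq_exp_mul hp0, mul_add, mul_one, add_sub_cancel_left, norm_mul, Complex.norm_exp,
        hz₀re, mul_comm]
      gcongr
    have hangle : Real.cos z₀.im = √2 / 2 ∧ s * Real.sin z₀.im = √2 / 2 := by
      have e : z₀.im = s * (Real.pi / 4) + m * (2 * Real.pi) := by rw [hz₀im]; ring
      rw [e, Real.cos_add_nat_mul_two_pi, Real.sin_add_nat_mul_two_pi]
      rcases hs with rfl | rfl <;> simp
    have hsq : (7 / 5 : ℝ) ≤ √2 := Real.le_sqrt_of_sq_le (by norm_num)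
    have hre := (Complex.abs_re_le_norm _).trans hdiff
    have him := (Complex.abs_im_le_norm _).trans hdiff
    have hims : |s * (f p z₀ - Complex.exp z₀).im| ≤ 1 / 8 * Real.exp (c - 1) := by
      rwa [abs_mul, hs1, one_mul]
    rw [Complex.sub_re, Complex.exp_re, hangle.1, hz₀re] at hre
    have e2 : s * (f p z₀ - Complex.exp z₀).im
        = s * (f p z₀).im - Real.exp (c - 1) * (s * Real.sin z₀.im) := by
      rw [Complex.sub_im, Complex.exp_im, hz₀re]
      ring
    rw [e2, hangle.2] at hims
    have h1 := (abs_le.1 hre).1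
    have h2 := (abs_le.1 hims).1
    refine ⟨by nlinarith, by nlinarith, ?_⟩
    have h3 := (hexpand z₀ ht₀).2
    rw [hz₀re] at h3
    have := Real.exp_one_gt_d9
    rw [hcX]
    nlinarith
  have huniq : ∀ z ∈ trapezium p m c, f p z = f p z₀ → z = z₀ := by
    intro z hz hfz
    have hsec := trapezium_subset_sector hm c hz
    -- Any other preimage is far to the right too: `7/8 * e^(c-1) ≤ |f z| ≤ p * e^(re z)`, which is
    -- where `log (2p)` in `hc₁` comes from.
    have hzre : c₁ ≤ z.re := by
      have h1 := norm_fDeriv_le hp 0 hsec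
      rw [fDeriv_zero, hfz] at h1
      have h2 := (hexpand z₀ ht₀).1.trans h1
      rw [hz₀re] at h2
      have h3 : Real.exp (c - 1) ≤ Real.exp (Real.log (2 * p) + z.re) := by
        rw [Real.exp_add, Real.exp_log (by linarith)]
        have : 0 < p * Real.exp z.re := by positivity
        linarith
      have := Real.exp_le_exp.1 h3
      linarith
    have ht := htail z hzre (habs z hz)
    have htt := htail' z₀ z (by rw [hz₀re]; linarith) (habs z₀ hz₀) hzre (habs z hz)
    have hE : (1 + tail p z) * (Complex.exp (z - z₀) - 1) = tail p z₀ - tail p z := by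
      rw [f_eq_exp_mul hp0, f_eq_exp_mul hp0] at hfz
      rw [Complex.exp_sub]
      have := Complex.exp_ne_zero z₀
      field_simp
      linear_combination hfz
    have hn := congrArg norm hE
    rw [norm_mul] at hn
    have h7 : 7 / 8 ≤ ‖1 + tail p z‖ := by
      have h2 := norm_sub_le (1 + tail p z) (tail p z)
      rw [add_sub_cancel_right, norm_one] at h2
      linarith
    have h8 : 7 / 8 * ‖Complex.exp (z - z₀) - 1‖ ≤ ‖tail p z₀ - tail p z‖ := by
      rw [← hn]
      gcongr
    have h9 := norm_sub_le (tail p z₀) (tail p z)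
    rw [norm_sub_rev z₀] at htt
    -- The imaginary parts differ by at most `π + π/4 < 3π/2`.
    refine sub_eq_zero.1 (eq_of_exp_sub_one_small ?_ (by linarith)
      (by linarith [norm_nonneg (z - z₀)]))
    rw [Complex.sub_im, hz₀im, abs_lt]
    obtain ⟨hsπ1, hsπ2⟩ := hsπ
    have h10 := hz.1
    have h11 := hz.2.1
    constructor <;> linarith
  obtain ⟨hcov, hexp⟩ := covers_and_expands (differentiable_f p) (isCompact_trapezium hp m c) hU
    (fun z hz => ⟨hz.1.le, hz.2.1.le, hz.2.2.1.le, hz.2.2.2.le⟩) (isOpen_halfRegion _ _ _)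
    (convex_halfRegion _ _ _) hbdry hd hz₀ hf₀ huniq
  exact ⟨hcov, hexp, fun z hz hf => ⟨(hbdry z hz hf).1, (hbdry z hz hf).2.1⟩⟩

/-! ### All trapeziums and the conjugacy -/

theorem trapezium_subset_halfRegion {p : ℕ} (hp : 3 ≤ p) {m : ℕ} (hm : 1 ≤ m) {B c Y : ℝ}
    (hB : B < m) (hY : (2 * (m : ℝ) + 1) * Real.pi ≤ Y) (hc : c + Y < Real.exp c / 2) :
    trapezium p m c ⊆ halfRegion B (Real.exp c / 2) 1 := by
  intro z hz
  have hsec := trapezium_subset_sector hm c hz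
  have hre := re_pos_of_mem_sector hp hsec
  have hbot := le_bottom hm
  obtain ⟨h1, h2, -, h4⟩ := hz
  refine ⟨hre, by linarith, ?_⟩
  have := Complex.norm_le_abs_re_add_abs_im z
  rw [abs_of_pos hre, abs_of_pos hsec.1] at this
  linarith

theorem conj_mem_halfRegion {B R s : ℝ} {z : ℂ} :
    (starRingEnd ℂ) z ∈ halfRegion B R s ↔ z ∈ halfRegion B R (-s) := by
  simp [halfRegion]

theorem trapezium_nonempty {p : ℕ} {m : ℕ} {c : ℝ}
    (hc : (2 * (m : ℝ) + 1) * Real.pi ≤ Real.tan (Real.pi / p) * c) :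
    (trapezium p m c).Nonempty := by
  have := Real.pi_pos
  refine ⟨⟨c, (2 * (m : ℝ) + 1) * Real.pi⟩, ?_, le_rfl, hc, le_rfl⟩
  change (2 * (m : ℝ) - 1) * Real.pi ≤ (2 * (m : ℝ) + 1) * Real.pi
  linarith

theorem mem_T_of_not_pos {p M : ℕ} {c : ℝ} {j : ℤ} (hj : ¬0 < j) {z : ℂ} :
    z ∈ T p M c j ↔ (starRingEnd ℂ) z ∈ trapezium p (M + (j.natAbs - 1)) c := by
  rw [T, if_neg hj]
  constructor
  · rintro ⟨w, hw, rfl⟩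
    rwa [Complex.conj_conj]
  · exact fun h => ⟨_, h, Complex.conj_conj z⟩

theorem mem_T_of_pos {p M : ℕ} {c : ℝ} {j : ℤ} (hj : 0 < j) {z : ℂ} :
    z ∈ T p M c j ↔ z ∈ trapezium p (M + (j.natAbs - 1)) c := by
  rw [T, if_pos hj]

instance finite_symbol (K : ℕ) : Finite (Symbol K) :=
  Finite.of_injective (β := Icc (-(K : ℤ)) K) (fun j => ⟨j, abs_le.1 j.2.2⟩) fun i j h => by
    simpa [Subtype.ext_iff] using h

end ExpSum

theorem mainTheorem3 (p : ℕ) (hp : 3 ≤ p) :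
    ∃ M₀ : ℕ, ∀ M : ℕ, M₀ ≤ M → ∀ K : ℕ, 1 ≤ K → ∃ c₀ : ℝ, ∀ c : ℝ, c₀ ≤ c →
      ∃ h : ExpSum.Lam p M K c ≃ₜ ExpSum.SeqSpace K,
        Function.Semiconj h
          ((ExpSum.mapsTo_Lam p M K c).restrict (ExpSum.f p)
            (ExpSum.Lam p M K c) (ExpSum.Lam p M K c))
          (ExpSum.shift K) := by
  open ExpSum in
  have hp0 : p ≠ 0 := by omega
  have ht := tan_pos hp
  have hsin := sin_pos hp
  obtain ⟨Y₁, hY₁⟩ := exists_abs_im_f_le hp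
  obtain ⟨Y₂, hY₂⟩ := exists_re_f_nonpos hp
  set B : ℝ := 4 * p / Real.sin (Real.pi / p) with hBdef
  have hB : 0 ≤ B := by positivity
  -- A trapezium of index `m ≥ M₀` has `im z ≥ (2m-1)π ≥ m`, so it lies above `Y₁`, `Y₂` and `B`.
  obtain ⟨M₀, hM₀⟩ := exists_nat_gt (max (max Y₁ Y₂) B)
  have hM₀1 : Y₁ < M₀ := ((le_max_left _ _).trans (le_max_left _ _)).trans_lt hM₀
  have hM₀2 : Y₂ < M₀ := ((le_max_right _ _).trans (le_max_left _ _)).trans_lt hM₀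
  have hM₀3 : B < M₀ := (le_max_right _ _).trans_lt hM₀
  refine ⟨M₀, fun M hM K hK => ?_⟩
  set Y : ℝ := (2 * ((M + K : ℕ) : ℝ) + 1) * Real.pi with hYdef
  have hY0 : 0 ≤ Y := by
    have := Real.pi_pos
    positivity
  obtain ⟨c₁, hc₁, hc₁'⟩ := exists_tail_small hp Y (η := 1 / 8) (by norm_num)
  -- In order: uniqueness of the preimage of `f z₀`, `z₀` lying in the trapezium, `f z₀` lying above
  -- `B`, and the trapeziums having norm below `e^c / 2`.
  refine ⟨max (max (c₁ + 1 + Real.log (2 * p)) (1 + Y / Real.tan (Real.pi / p)))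
    (max (2 * B + 1) (4 + 4 * Y)), fun c hc => ?_⟩
  simp only [max_le_iff] at hc
  obtain ⟨⟨hca, hcb⟩, hcc, hcd⟩ := hc
  have hct : Y ≤ Real.tan (Real.pi / p) * (c - 1) := by
    rw [← div_le_iff₀' ht]
    linarith
  have hcB : B < Real.exp (c - 1) / 2 := by
    linarith [Real.add_one_le_exp (c - 1)]
  have hcY : c + Y < Real.exp c / 2 := by
    have := Real.quadratic_le_exp_of_nonneg (x := c) (by linarith)
    nlinarith
  set m : ℤ → ℕ := fun j => M + (j.natAbs - 1) with hm
  have hmM : ∀ j, M₀ ≤ m j := fun j => by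
    rw [hm]
    exact hM.trans (Nat.le_add_right _ _)
  have hM₀pos : 1 ≤ M₀ := by
    have : (0 : ℝ) < M₀ := hB.trans_lt hM₀3
    exact_mod_cast this
  have hm1 : ∀ j, 1 ≤ m j := fun j => hM₀pos.trans (hmM j)
  have hmR : ∀ j, (M₀ : ℝ) ≤ m j := fun j => by exact_mod_cast hmM j
  have hmY : ∀ j : Symbol K, (2 * (m j : ℝ) + 1) * Real.pi ≤ Y := fun j => by
    have h1 : m j ≤ M + K := by
      have := j.2.2
      rw [Int.abs_eq_natAbs] at this
      simp only [hm]
      omega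
    rw [hYdef]
    have := Real.pi_pos
    gcongr
  have hmain : ∀ (j : Symbol K) (s : ℝ), s = 1 ∨ s = -1 → _ := fun j s hs =>
    trapezium_covers_and_expands hp (hm1 j) hs hB
      (fun z hz hzm => hY₁ z hz (by linarith [hmR j]))
      (fun z hz hzm => hY₂ z hz (by linarith [hmR j]))
      (fun z hz hzY => hc₁ z hz (hzY.trans (hmY j)))
      (fun z z' hz hzY hz' hzY' => hc₁' z z' hz (hzY.trans (hmY j)) hz' (hzY'.trans (hmY j)))
      hca ((hmY j).trans hct) hcB
  have hsub : ∀ j : Symbol K, trapezium p (m j) c ⊆ halfRegion B (Real.exp c / 2) 1 := fun j =>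
    trapezium_subset_halfRegion hp (hm1 j) (hM₀3.trans_le (hmR j)) (hmY j) hcY
  have hregion : ∀ j : Symbol K, ∃ s : ℝ, (s = 1 ∨ s = -1) ∧
      T p M c j ⊆ halfRegion B (Real.exp c / 2) s := fun j => by
    by_cases hj : 0 < (j : ℤ)
    · exact ⟨1, Or.inl rfl, fun z hz => hsub j ((mem_T_of_pos hj).1 hz)⟩
    · exact ⟨-1, Or.inr rfl, fun z hz =>
        conj_mem_halfRegion.1 (hsub j ((mem_T_of_not_pos hj).1 hz))⟩
  have hneg : ∀ s : ℝ, s = 1 ∨ s = -1 → -s = 1 ∨ -s = -1 := by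
    rintro s (rfl | rfl) <;> simp
  have hconj : ∀ (z : ℂ) (s : ℝ), f p z ∈ halfRegion B (Real.exp c / 2) s →
      f p ((starRingEnd ℂ) z) ∈ halfRegion B (Real.exp c / 2) (-s) := fun z s h => by
    rwa [f_conj hp0, conj_mem_halfRegion, neg_neg]
  refine exists_homeomorph_semiconj_shift (differentiable_f p).continuous
    (T := fun j : Symbol K => T p M c j) ?_ ?_ ?_ ?_ ?_ rfl (mapsTo_Lam p M K c)
  · intro j
    change IsCompact (T p M c j)
    unfold T
    split_ifs
    · exact isCompact_trapezium hp _ c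
    · exact (isCompact_trapezium hp _ c).image Complex.continuous_conj
  · intro j
    have : (trapezium p (m j) c).Nonempty :=
      trapezium_nonempty ((hmY j).trans (hct.trans (by nlinarith)))
    change (T p M c j).Nonempty
    unfold T
    split_ifs
    · exact this
    · exact this.image _
  · intro i j z hz
    obtain ⟨s, hs, hsj⟩ := hregion j
    by_cases hi : 0 < (i : ℤ)
    · obtain ⟨w, hw, hwz⟩ := (hmain i s hs).1 (hsj hz)
      exact ⟨w, (mem_T_of_pos hi).2 hw, hwz⟩
    · have hz' : (starRingEnd ℂ) z ∈ halfRegion B (Real.exp c / 2) (-s) := by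
        rw [conj_mem_halfRegion, neg_neg]
        exact hsj hz
      obtain ⟨w, hw, hwz⟩ := (hmain i (-s) (hneg s hs)).1 hz'
      refine ⟨(starRingEnd ℂ) w, (mem_T_of_not_pos hi).2 (by rwa [Complex.conj_conj]), ?_⟩
      rw [f_conj hp0, hwz, Complex.conj_conj]
  -- A point whose image is in a trapezium is off the horizontal edges, so its height fixes `m` and
  -- the sign of `im z` fixes the sign of the symbol.
  · intro i j k z hzi hzj hzk
    obtain ⟨s, hs, hsk⟩ := hregion k
    have hlt : ∀ (i j : ℤ) (y : ℝ), (2 * (m i : ℝ) - 1) * Real.pi < y →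
        y < (2 * (m j : ℝ) + 1) * Real.pi → m i ≤ m j := fun i j y h1 h2 => by
      have h3 := lt_of_mul_lt_mul_right (h1.trans h2) Real.pi_pos.le
      have h4 : (m i : ℝ) < m j + 1 := by linarith
      exact Nat.lt_succ_iff.1 (by exact_mod_cast h4)
    have hmeq : m i = m j → ((0 < (i : ℤ)) ↔ 0 < (j : ℤ)) → i = j := fun h h' => by
      have hi := i.2.1
      have hj := j.2.1
      rw [Int.abs_eq_natAbs] at hi hj
      simp only [hm] at h
      apply Subtype.ext
      omega
    have him : ∀ l : Symbol K, z ∈ T p M c l → (0 < (l : ℤ) ↔ 0 < z.im) := fun l hl => by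
      by_cases hl0 : 0 < (l : ℤ)
      · simp only [hl0, true_iff]
        exact (trapezium_subset_sector (hm1 l) c ((mem_T_of_pos hl0).1 hl)).1
      · simp only [hl0, false_iff, not_lt]
        have := (trapezium_subset_sector (hm1 l) c ((mem_T_of_not_pos hl0).1 hl)).1
        rw [Complex.conj_im] at this
        linarith
    have hij := (him i hzi).trans (him j hzj).symm
    refine hmeq ?_ hij
    by_cases hi : 0 < (i : ℤ)
    · have h1 := (hmain i s hs).2.2 z ((mem_T_of_pos hi).1 hzi) (hsk hzk)
      have h2 := (hmain j s hs).2.2 z ((mem_T_of_pos (hij.1 hi)).1 hzj) (hsk hzk)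
      exact le_antisymm (hlt _ _ _ h1.1 h2.2) (hlt _ _ _ h2.1 h1.2)
    · have h1 := (hmain i (-s) (hneg s hs)).2.2 _ ((mem_T_of_not_pos hi).1 hzi)
        (hconj z s (hsk hzk))
      have h2 := (hmain j (-s) (hneg s hs)).2.2 _
        ((mem_T_of_not_pos (fun h => hi (hij.2 h))).1 hzj) (hconj z s (hsk hzk))
      exact le_antisymm (hlt _ _ _ h1.1 h2.2) (hlt _ _ _ h2.1 h1.2)
  · intro i j z z' hz hz' hfz hfz'
    obtain ⟨s, hs, hsj⟩ := hregion j
    rw [dist_eq_norm, dist_eq_norm]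
    by_cases hi : 0 < (i : ℤ)
    · exact (hmain i s hs).2.1 z ((mem_T_of_pos hi).1 hz) z' ((mem_T_of_pos hi).1 hz')
        (hsj hfz) (hsj hfz')
    · have := (hmain i (-s) (hneg s hs)).2.1 _ ((mem_T_of_not_pos hi).1 hz) _
        ((mem_T_of_not_pos hi).1 hz') (hconj z s (hsj hfz)) (hconj z' s (hsj hfz'))
      rwa [f_conj hp0, f_conj hp0, ← map_sub, ← map_sub, Complex.norm_conj,
        Complex.norm_conj] at this
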